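/- Let $\mathbb{D}$ be the open unit disc in $\mathbb{C}$. For $n\ge 2$ let $\mathbb{G}_{1,n}$ (the $\mu_{1,n}$-quotient) be the set of all $(x,y)\in\mathbb{C}^n\times\mathbb{C}^{n-1}$ such that $$\Big(1+\sum_{j=1}^{n-1}(-1)^j y_j z^j\Big)-w\sum_{j=0}^{n-1}(-1)^j x_{j+1}z^j\neq 0\qquad\text{for all }(z,w)\in\overline{\mathbb{D}}^2 .$$ Theorem 3.4. Let $n\ge 3$ and $(x,y)\in\mathbb{C}^n\times\mathbb{C}^{n-1}$. The following are equivalent: (i) $(x,y)\in\mathbb{G}_{1,n}$. (ii) For every $\xi\in\overline{\mathbb{D}}$, $(n-1)-\xi y_1\neq 0$ and the point $(\widetilde{x}(\xi),\widetilde{y}(\xi))\in\mathbb{C}^{n-1}\times\mathbb{C}^{n-2}$ belongs to $\mathbb{G}_{1,n-1}$, where $$\widetilde{x}_j(\xi)=\frac{(n-j)x_j-j\xi x_{j+1}}{(n-1)-\xi y_1},\quad j=1,\dots,n-1,$$ $$\widetilde{y}_j(\xi)=\frac{(n-1-j)y_j-(j+1)\xi y_{j+1}}{(n-1)-\xi y_1},\quad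 j=1,\dots,n-2.$$ -/

import Mathlib

noncomputable section

namespace MuQuotient

/-- The polynomial `P_n(z; x) = ∑_{j=0}^{n-1} (-1)^j x_{j+1} z^j`. The coordinates
`x_1, …, x_n` are stored at the indices `0, …, n-1` of `Fin n`. -/
def P (n : ℕ) (x : Fin n → ℂ) (z : ℂ) : ℂ :=
  ∑ j : Fin n, (-1 : ℂ) ^ (j : ℕ) * x j * z ^ (j : ℕ)

/-- The polynomial `Q_n(z; y) = 1 + ∑_{j=1}^{n-1} (-1)^j y_j z^j`. The coordinates
`y_1, …, y_{n-1}` are stored at the indices `0, …, n-2` of `Fin (n - 1)`. -/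
def Q (n : ℕ) (y : Fin (n - 1) → ℂ) (z : ℂ) : ℂ :=
  1 + ∑ j : Fin (n - 1), (-1 : ℂ) ^ ((j : ℕ) + 1) * y j * z ^ ((j : ℕ) + 1)

/-- The `μ_{1,n}`-quotient: the set of `(x, y) ∈ ℂ^n × ℂ^{n-1}` for which the zero set of
`(z, w) ↦ Q_n(z; y) - w P_n(z; x)` does not meet the closed unit bidisc. -/
def G (n : ℕ) : Set ((Fin n → ℂ) × (Fin (n - 1) → ℂ)) :=
  {p | ∀ z ∈ Metric.closedBall (0 : ℂ) 1, ∀ w ∈ Metric.closedBall (0 : ℂ) 1,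
    Q n p.2 z - w * P n p.1 z ≠ 0}

/-- The common denominator `(n - 1) - ξ y_1`. -/
def denom (n : ℕ) (hn : 3 ≤ n) (y : Fin (n - 1) → ℂ) (ξ : ℂ) : ℂ :=
  ((n : ℂ) - 1) - ξ * y ⟨0, by omega⟩

/-- `x̃_j(ξ) = ((n - j) x_j - j ξ x_{j+1}) / ((n - 1) - ξ y_1)` for `j = 1, …, n-1`;
the index `i` of `Fin (n - 1)` stands for `j = i + 1`. -/
def xTilde (n : ℕ) (hn : 3 ≤ n) (x : Fin n → ℂ) (y : Fin (n - 1) → ℂ) (ξ : ℂ) :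
    Fin (n - 1) → ℂ := fun i =>
  (((n : ℂ) - ((i : ℕ) + 1 : ℂ)) * x ⟨i, by omega⟩
    - ((i : ℕ) + 1 : ℂ) * ξ * x ⟨i + 1, by omega⟩) / denom n hn y ξ

/-- `ỹ_j(ξ) = ((n - 1 - j) y_j - (j + 1) ξ y_{j+1}) / ((n - 1) - ξ y_1)` for
`j = 1, …, n-2`; the index `i` of `Fin (n - 1 - 1)` stands for `j = i + 1`. -/
def yTilde (n : ℕ) (hn : 3 ≤ n) (y : Fin (n - 1) → ℂ) (ξ : ℂ) :
    Fin (n - 1 - 1) → ℂ := fun i =>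
  (((n : ℂ) - 1 - ((i : ℕ) + 1 : ℂ)) * y ⟨i, by omega⟩
    - (((i : ℕ) + 1 : ℂ) + 1) * ξ * y ⟨i + 1, by omega⟩) / denom n hn y ξ

end MuQuotient

end

open Polynomial

namespace MuQuotient

/-- For `‖z‖ ≤ 1`, a point `r` outside the closed unit disc has `u = (z - r)⁻¹` in the convex set
`(1 - ‖z‖ ^ 2) ‖u‖ ^ 2 + 2 Re (z u) < 1`. -/
lemma norm_inv_sub_lt {z r : ℂ} (hz : ‖z‖ ≤ 1) (hr : 1 < ‖r‖) :
    (1 - ‖z‖ ^ 2) * ‖(z - r)⁻¹‖ ^ 2 + 2 * (z * (z - r)⁻¹).re < 1 := by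
  have hne : z - r ≠ 0 := by
    intro h
    rw [sub_eq_zero.mp h] at hz
    linarith
  set u := (z - r)⁻¹ with hu
  have hu0 : u ≠ 0 := inv_ne_zero hne
  have hru : r * u = z * u - 1 := by
    rw [hu]; field_simp; ring
  have h1 : ‖r‖ ^ 2 * ‖u‖ ^ 2 = ‖z‖ ^ 2 * ‖u‖ ^ 2 - 2 * (z * u).re + 1 := by
    rw [← mul_pow, ← mul_pow, ← norm_mul, ← norm_mul, hru, Complex.sq_norm, Complex.sq_norm,
      Complex.normSq_apply, Complex.normSq_apply]
    simp only [Complex.sub_re, Complex.sub_im, Complex.one_re, Complex.one_im]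
    ring
  have h2 : 0 < ‖u‖ ^ 2 := by positivity
  nlinarith [mul_pos h2 (by nlinarith : 0 < ‖r‖ ^ 2 - 1)]

/-- For `‖z‖ ≤ 1`, a point `ξ ≠ z` of the closed unit disc has `u = (z - ξ)⁻¹` outside the convex
set of `norm_inv_sub_lt`. -/
lemma le_norm_inv_sub {z ξ : ℂ} (hξ : ‖ξ‖ ≤ 1) (hne : z - ξ ≠ 0) :
    1 ≤ (1 - ‖z‖ ^ 2) * ‖(z - ξ)⁻¹‖ ^ 2 + 2 * (z * (z - ξ)⁻¹).re := by
  set u := (z - ξ)⁻¹ with hu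
  have hru : ξ * u = z * u - 1 := by
    rw [hu]; field_simp; ring
  have h1 : ‖ξ‖ ^ 2 * ‖u‖ ^ 2 = ‖z‖ ^ 2 * ‖u‖ ^ 2 - 2 * (z * u).re + 1 := by
    rw [← mul_pow, ← mul_pow, ← norm_mul, ← norm_mul, hru, Complex.sq_norm, Complex.sq_norm,
      Complex.normSq_apply, Complex.normSq_apply]
    simp only [Complex.sub_re, Complex.sub_im, Complex.one_re, Complex.one_im]
    ring
  have h2 : ‖ξ‖ ^ 2 ≤ 1 := pow_le_one₀ (norm_nonneg _) hξ
  nlinarith [mul_nonneg (sq_nonneg ‖u‖) (sub_nonneg.mpr h2)]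

lemma convex_norm_sq_add_re_lt {z : ℂ} (hz : ‖z‖ ≤ 1) :
    Convex ℝ {u : ℂ | (1 - ‖z‖ ^ 2) * ‖u‖ ^ 2 + 2 * (z * u).re < 1} := by
  have hz2 : 0 ≤ 1 - ‖z‖ ^ 2 := sub_nonneg.mpr (pow_le_one₀ (norm_nonneg _) hz)
  have h1 : ConvexOn ℝ Set.univ fun u : ℂ => (1 - ‖z‖ ^ 2) * ‖u‖ ^ 2 := by
    exact ((convexOn_norm convex_univ).pow (fun _ _ => norm_nonneg _) 2).smul hz2
  have h2 : ConvexOn ℝ Set.univ fun u : ℂ => 2 * (z * u).re := by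
    refine ⟨convex_univ, fun u _ v _ a b _ _ _ => le_of_eq ?_⟩
    simp
    ring
  simpa using (h1.add h2).convex_lt 1

/-- A sum of at most `d` elements of a convex set containing `0` is `d` times an element of it. -/
lemma inv_smul_multiset_sum_mem {s : Set ℂ} (hs : Convex ℝ s) (h0 : (0 : ℂ) ∈ s) {d : ℕ} (hd : 0 < d)
    (m : Multiset ℂ) (hm : ∀ u ∈ m, u ∈ s) (hcard : Multiset.card m ≤ d) :
    (d : ℝ)⁻¹ • m.sum ∈ s := by
  suffices H : ∀ m : Multiset ℂ, (∀ u ∈ m, u ∈ s) → Multiset.card m ≤ d →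
      ∃ v ∈ s, m.sum = ((Multiset.card m : ℕ) : ℝ) • v by
    obtain ⟨v, hv, hsum⟩ := H m hm hcard
    rw [hsum, smul_smul]
    refine hs.smul_mem_of_zero_mem h0 hv ⟨by positivity, ?_⟩
    rw [inv_mul_le_iff₀ (by positivity)]
    simpa using hcard
  intro m
  induction m using Multiset.induction with
  | empty => exact fun _ _ => ⟨0, h0, by simp⟩
  | cons a m ih =>
    intro hm hcard
    obtain ⟨v, hv, hsum⟩ := ih (fun u hu => hm u (Multiset.mem_cons_of_mem hu))
      (by rw [Multiset.card_cons] at hcard; omega)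
    set k : ℝ := ((Multiset.card m : ℕ) : ℝ) with hk
    have hk0 : 0 ≤ k := Nat.cast_nonneg _
    have hk1 : k + 1 ≠ 0 := by positivity
    refine ⟨(k + 1)⁻¹ • a + (k * (k + 1)⁻¹) • v,
      hs (hm a (Multiset.mem_cons_self a m)) hv (by positivity) (by positivity) ?_, ?_⟩
    · field_simp
      ring
    · rw [Multiset.sum_cons, hsum, Multiset.card_cons, Nat.cast_succ, ← hk, smul_add, smul_smul,
        smul_smul, mul_inv_cancel₀ hk1, one_smul]
      congr 2
      field_simp

/-- Laguerre's theorem on polar derivatives for the closed unit disc. -/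
theorem polar_derivative_ne_zero {p : ℂ[X]} {d : ℕ} (hd : 0 < d) (hp : p.natDegree ≤ d)
    (h : ∀ z : ℂ, ‖z‖ ≤ 1 → p.eval z ≠ 0) {z ξ : ℂ} (hz : ‖z‖ ≤ 1) (hξ : ‖ξ‖ ≤ 1) :
    (d : ℂ) * p.eval z + (ξ - z) * p.derivative.eval z ≠ 0 := by
  have hd0 : (d : ℂ) ≠ 0 := Nat.cast_ne_zero.mpr hd.ne'
  intro heq
  have hpz := h z hz
  have hne : z - ξ ≠ 0 := by
    intro hzξ
    have : ξ - z = 0 := by rw [← neg_sub, hzξ, neg_zero]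
    rw [this, zero_mul, add_zero] at heq
    exact mul_ne_zero hd0 hpz heq
  have hlog := (IsAlgClosed.splits p).eval_derivative_div_eval_of_ne_zero hpz
  have hmem := inv_smul_multiset_sum_mem (convex_norm_sq_add_re_lt hz) (by simp) hd
    (p.roots.map fun r => (z - r)⁻¹)
    (fun u hu => by
      obtain ⟨r, hr, rfl⟩ := Multiset.mem_map.mp hu
      refine norm_inv_sub_lt hz (not_le.mp fun hr1 => h r hr1 ?_)
      exact (mem_roots'.mp hr).2)
    (by rw [Multiset.card_map]; exact (card_roots' p).trans hp)
  have hsum : (d : ℝ)⁻¹ • (p.roots.map fun r => (z - r)⁻¹).sum = (z - ξ)⁻¹ := by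
    simp only [one_div] at hlog
    rw [← hlog, Complex.real_smul]
    push_cast
    field_simp
    linear_combination -heq
  rw [hsum] at hmem
  exact (le_norm_inv_sub hξ hne).not_gt hmem

/-- The polynomial `∑_{j ≤ d} (-1)^j c_j X^j`. -/
noncomputable def altPoly (d : ℕ) (c : ℕ → ℂ) : ℂ[X] :=
  ∑ j ∈ Finset.range (d + 1), C ((-1) ^ j * c j) * X ^ j

lemma eval_altPoly (d : ℕ) (c : ℕ → ℂ) (z : ℂ) :
    (altPoly d c).eval z = ∑ j ∈ Finset.range (d + 1), (-1) ^ j * c j * z ^ j := by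
  simp [altPoly, eval_finsetSum]

lemma natDegree_altPoly_le (d : ℕ) (c : ℕ → ℂ) : (altPoly d c).natDegree ≤ d :=
  natDegree_sum_le_of_forall_le _ _ fun j hj =>
    (natDegree_C_mul_X_pow_le _ j).trans (Nat.lt_succ_iff.mp (Finset.mem_range.mp hj))

lemma eval_altPoly_polar (d : ℕ) (c : ℕ → ℂ) (z ξ : ℂ) :
    (d + 1 : ℂ) * (altPoly (d + 1) c).eval z
        + (ξ - z) * (altPoly (d + 1) c).derivative.eval z =
      (altPoly d fun j => (d + 1 - j) * c j - (j + 1) * ξ * c (j + 1)).eval z := by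
  have hder : (altPoly (d + 1) c).derivative.eval z =
      ∑ j ∈ Finset.range (d + 2), (-1) ^ j * c j * (j * z ^ (j - 1)) := by
    simp only [altPoly, derivative_sum, derivative_C_mul, derivative_X_pow, eval_finsetSum,
      eval_mul, eval_pow, eval_X, eval_C]
  have h1 : (d + 1 : ℂ) * (altPoly (d + 1) c).eval z
      - z * (altPoly (d + 1) c).derivative.eval z =
      ∑ j ∈ Finset.range (d + 1), (-1) ^ j * ((d + 1 - j) * c j) * z ^ j := by
    rw [hder, eval_altPoly, Finset.mul_sum, Finset.mul_sum, ← Finset.sum_sub_distrib,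
      Finset.sum_range_succ]
    have hlast : (d + 1 : ℂ) * ((-1) ^ (d + 1) * c (d + 1) * z ^ (d + 1)) -
        z * ((-1) ^ (d + 1) * c (d + 1) * (((d + 1 : ℕ) : ℂ) * z ^ (d + 1 - 1))) = 0 := by
      rw [Nat.add_sub_cancel]
      push_cast
      ring
    rw [hlast, add_zero]
    refine Finset.sum_congr rfl fun j _ => ?_
    rcases j with _ | j
    · simp
    · rw [Nat.add_sub_cancel]; push_cast; ring
  have h2 : (altPoly (d + 1) c).derivative.eval z =
      ∑ j ∈ Finset.range (d + 1), -((-1) ^ j * ((j + 1) * c (j + 1)) * z ^ j) := by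
    rw [hder, Finset.sum_range_succ']
    simp only [Nat.cast_zero, zero_mul, mul_zero, add_zero]
    refine Finset.sum_congr rfl fun j _ => ?_
    rw [Nat.add_sub_cancel]; push_cast; ring
  rw [sub_mul, ← add_sub_assoc, add_sub_right_comm, h1, h2, eval_altPoly, Finset.mul_sum,
    ← Finset.sum_add_distrib]
  refine Finset.sum_congr rfl fun j _ => ?_
  ring

/-- The coefficient sequence of `Q_n - w P_n`, signs removed and extended by zero. -/
noncomputable def coeffSeq {n : ℕ} (x : Fin n → ℂ) (y : Fin (n - 1) → ℂ) (w : ℂ) : ℕ → ℂ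
  | 0 => 1 - w * (if h : 0 < n then x ⟨0, h⟩ else 0)
  | j + 1 => (if h : j < n - 1 then y ⟨j, h⟩ else 0) -
      w * (if h : j + 1 < n then x ⟨j + 1, h⟩ else 0)

lemma Q_sub_mul_P (d : ℕ) (x : Fin (d + 1) → ℂ) (y : Fin (d + 1 - 1) → ℂ) (z w : ℂ) :
    Q (d + 1) y z - w * P (d + 1) x z = (altPoly d (coeffSeq x y w)).eval z := by
  rw [eval_altPoly, Finset.sum_range_succ', Finset.sum_range, P, Q, Fin.sum_univ_succ,
    mul_add]
  have : ∀ i : Fin d, (-1 : ℂ) ^ ((i : ℕ) + 1) * coeffSeq x y w (i + 1) * z ^ ((i : ℕ) + 1) =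
      (-1 : ℂ) ^ ((i : ℕ) + 1) * y i * z ^ ((i : ℕ) + 1)
        - w * ((-1 : ℂ) ^ ((i : ℕ) + 1) * x i.succ * z ^ ((i : ℕ) + 1)) := by
    intro i
    have h1 : (i : ℕ) < d + 1 - 1 := i.2
    have h2 : (i : ℕ) + 1 < d + 1 := Nat.succ_lt_succ i.2
    simp only [coeffSeq, dif_pos h1, dif_pos h2]
    change _ * (y i - w * x i.succ) * _ = _
    ring
  rw [Finset.sum_congr rfl fun i _ => this i, Finset.sum_sub_distrib]
  simp only [coeffSeq, dif_pos d.succ_pos, Finset.mul_sum, Fin.val_zero, Fin.val_succ,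
    pow_zero, one_mul, mul_one]
  have hring : ∀ a b c : ℂ, 1 + a - (c + b) = a - b + (1 - c) := fun a b c => by ring
  exact hring _ _ _

/-- Up to the common denominator, the polynomial of `(x̃(ξ), ỹ(ξ))` is the polar derivative of
the polynomial of `(x, y)`. -/
lemma denom_mul_tilde (d : ℕ) (hn : 3 ≤ d + 2) (x : Fin (d + 2) → ℂ) (y : Fin (d + 2 - 1) → ℂ)
    {ξ : ℂ} (hden : denom (d + 2) hn y ξ ≠ 0) (z w : ℂ) :
    denom (d + 2) hn y ξ * (Q (d + 1) (yTilde (d + 2) hn y ξ) z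
        - w * P (d + 1) (xTilde (d + 2) hn x y ξ) z) =
      (d + 1 : ℂ) * (altPoly (d + 1) (coeffSeq x y w)).eval z
        + (ξ - z) * (altPoly (d + 1) (coeffSeq x y w)).derivative.eval z := by
  rw [eval_altPoly_polar, Q_sub_mul_P, eval_altPoly, eval_altPoly, Finset.mul_sum]
  refine Finset.sum_congr rfl fun j hj => ?_
  have hj : j < d + 1 := Finset.mem_range.mp hj
  suffices H : denom (d + 2) hn y ξ * coeffSeq (n := d + 1) (xTilde (d + 2) hn x y ξ)
      (yTilde (d + 2) hn y ξ) w j = (d + 1 - j) * coeffSeq x y w j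
        - (j + 1) * ξ * coeffSeq x y w (j + 1) by
    rw [← H]; ring
  rcases j with _ | j
  · simp only [coeffSeq, xTilde]
    rw [dif_pos (by omega), dif_pos (by omega), dif_pos (by omega), dif_pos (by omega)]
    field_simp
    simp only [denom]
    push_cast
    ring
  · have h1 : j < d := by omega
    simp only [coeffSeq, xTilde, yTilde]
    rw [dif_pos (by omega), dif_pos (by omega), dif_pos (by omega), dif_pos (by omega),
      dif_pos (by omega), dif_pos (by omega)]
    field_simp
    push_cast
    ring

end MuQuotient

theorem theorem3p4 (n : ℕ) (hn : 3 ≤ n) (x : Fin n → ℂ) (y : Fin (n - 1) → ℂ) :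
    (x, y) ∈ MuQuotient.G n ↔
      ∀ ξ ∈ Metric.closedBall (0 : ℂ) 1,
        MuQuotient.denom n hn y ξ ≠ 0 ∧
          (MuQuotient.xTilde n hn x y ξ, MuQuotient.yTilde n hn y ξ) ∈
            MuQuotient.G (n - 1) := by
  obtain ⟨d, rfl⟩ : ∃ d, n = d + 2 := ⟨n - 2, by omega⟩
  have hball : ∀ {z : ℂ}, z ∈ Metric.closedBall (0 : ℂ) 1 ↔ ‖z‖ ≤ 1 := mem_closedBall_zero_iff
  constructor
  · intro hG ξ hξ
    have hpolar : ∀ z w : ℂ, ‖z‖ ≤ 1 → ‖w‖ ≤ 1 →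
        (d + 1 : ℂ) * (MuQuotient.altPoly (d + 1) (MuQuotient.coeffSeq x y w)).eval z
          + (ξ - z) *
            (MuQuotient.altPoly (d + 1) (MuQuotient.coeffSeq x y w)).derivative.eval z ≠ 0 := by
      intro z w hz hw
      exact_mod_cast MuQuotient.polar_derivative_ne_zero d.succ_pos
        (MuQuotient.natDegree_altPoly_le _ _)
        (fun z hz => by
          rw [← MuQuotient.Q_sub_mul_P]
          exact hG z (hball.mpr hz) w (hball.mpr hw))
        hz (hball.mp hξ)
    have hden : MuQuotient.denom (d + 2) hn y ξ ≠ 0 := by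
      have h0 := hpolar 0 0 (by simp) (by simp)
      rw [MuQuotient.eval_altPoly_polar, MuQuotient.eval_altPoly, Finset.sum_range_succ'] at h0
      simpa [MuQuotient.coeffSeq, MuQuotient.denom, add_sub_assoc,
        show (2 : ℂ) - 1 = 1 by norm_num] using h0
    refine ⟨hden, fun z hz w hw hzero => hpolar z w (hball.mp hz) (hball.mp hw) ?_⟩
    rw [← MuQuotient.denom_mul_tilde d hn x y hden]
    exact mul_eq_zero_of_right _ hzero
  · intro h z hz w hw hzero
    obtain ⟨hden, hmem⟩ := h z hz
    refine mul_ne_zero hden (hmem z hz w hw) ((MuQuotient.denom_mul_tilde d hn x y hden z w).trans ?_)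
    rw [sub_self, zero_mul, add_zero, ← MuQuotient.Q_sub_mul_P]
    exact mul_eq_zero_of_right _ hzero
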